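/- For $0<p<1$ and an integer $N\ge 0$, let $A$ be a random subset of $\{0,\dots,N\}$ that contains each $n\in\{0,\dots,N\}$ independently with probability $p$, let $A+A=\{a+b : a,b\in A\}$, and let $$Y=Y_{N,p}=\bigl|\{\,0\le n\le N : n\notin A+A\,\}\bigr| .$$ For every $p\in(0,1)$ the limits $$\mathbb E[Y]_\infty:=\lim_{N\to\infty}\mathbb E[Y],\qquad \mathbb E[Y^2]_\infty:=\lim_{N\to\infty}\mathbb E[Y^2]$$ exist and are finite, and $\mathbb E[Y]_\infty=\frac{2}{p^2}-\frac1p-1>0$. Moreover $$\lim_{p\to0^+}\frac{\mathbb E[Y^2]_\infty-(\mathbb E[Y]_\infty)^2}{(\mathbb E[Y]_\infty)^2}=\lim_{p\to0^+}\left(\frac{p^4\,\mathbb E[Y^2]_\infty}{4}-1\right)=0 .$$ Consequently, for small $p$ and large $N$ the random variable $Y/\mathbb E[Y]$ concentrates at $1$: for all $\varepsilon,\eta>0$ there is $p_0\in(0,1)$ such that for every $p\in(0,p_0)$ there is $N_0$ with $$\mathbb P\left(\left|\frac{Y}{\mathbb E[Y]}-1\right|\ge\varepsilon\right)\le\eta\qquad\text{for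 all } N\ge N_0 .$$ -/

import Mathlib

open MeasureTheory ProbabilityTheory Filter Topology
open scoped Pointwise unitInterval

/-- The number `Y` of integers `0 ≤ n ≤ N` that are missing from the sumset `A + A`. -/
noncomputable def leftMissing (N : ℕ) (A : Set ℕ) : ℕ :=
  {n : ℕ | n ≤ N ∧ n ∉ A + A}.ncard

/-- The law of the random subset `A` of `{0, …, N}` that contains each element of `{0, …, N}`
independently with probability `p`. -/
noncomputable def randomSubset (N : ℕ) (p : I) : Measure (Set ℕ) :=
  setBernoulli (Set.Iic N) p

/-- The expectation `E[Y]`, for given `N` and `p`. -/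
noncomputable def meanY (N : ℕ) (p : I) : ℝ :=
  ∫ A, (leftMissing N A : ℝ) ∂randomSubset N p

/-- The second moment `E[Y ^ 2]`, for given `N` and `p`. -/
noncomputable def secondMomentY (N : ℕ) (p : I) : ℝ :=
  ∫ A, (leftMissing N A : ℝ) ^ 2 ∂randomSubset N p

/-!
The second moment of `Y` is asymptotically the square of its mean, and Chebyshev's inequality then
gives concentration.

A number `n` is missing from `A + A` exactly when `A` contains none of the `(n + 1) / 2` disjoint
pairs `{a, n - a}` and, for even `n`, does not contain `n / 2`. These events are independent, so `n`
is missing with probability `(1 - p²) ^ ((n + 1) / 2)`, times `1 - p` for even `n`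
(`bernoulliSum_missing`). Two geometric series give the mean `2 / p² - 1 / p - 1`.

For `m ≠ n`, the pairs with sum `m` or `n` are the edges of a graph of maximum degree two, and both
`m` and `n` can be missing only if `A` is independent in this graph. Each edge multiplies
the probability of independence by a factor of at most `r = 1 - p² (1 - p)²`
(`bernoulliSum_edgeFree_insert_le`): given that `A` avoids the other edges, resampling `A` at `u`,
`v` and their at most two other neighbours produces, with probability at least `p² (1 - p)²`, a set
whose only edge is `{u, v}`. Hence `m` and `n` are both missing with probability at most
`r ^ ((m + 1) / 2 + (n + 1) / 2)`, and summation yields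
`E[Y ^ 2] ≤ E[Y] + (2 / (p² (1 - p)²)) ^ 2` uniformly in `N`
(`bernoulliSum_missingCount_sq_le_limit`). As `E[Y ^ 2]` increases with `N`, its limit exists. Both
this bound and the lower bound `E[Y] ^ 2 ≤ E[Y ^ 2]` are asymptotic to `4 / p ^ 4` as `p → 0`.

All expectations are computed as the finite sums `bernoulliSum`, in which one coordinate of the
random set can be integrated out at a time; `integral_randomSubset` and `randomSubset_real_eq`
identify them with integrals and probabilities for the measure `randomSubset`.
-/

/-! ### Expectations over a finite random set -/

/-- The expectation of `g s`, where `s` is a random subset of the finite set `U` that contains each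
element independently with probability `p`. -/
noncomputable def bernoulliSum (U : Finset ℕ) (p : ℝ) (g : Finset ℕ → ℝ) : ℝ :=
  ∑ s ∈ U.powerset, p ^ s.card * (1 - p) ^ (U \ s).card * g s

lemma bernoulliSum_insert {U : Finset ℕ} {x : ℕ} (hx : x ∉ U) (p : ℝ) (g : Finset ℕ → ℝ) :
    bernoulliSum (insert x U) p g =
      p * bernoulliSum U p (fun s => g (insert x s)) + (1 - p) * bernoulliSum U p g := by
  unfold bernoulliSum
  rw [Finset.sum_powerset_insert hx, add_comm, Finset.mul_sum, Finset.mul_sum]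
  congr 1
  · refine Finset.sum_congr rfl fun s hs => ?_
    have hxs : x ∉ s := fun h => hx (Finset.mem_powerset.1 hs h)
    have : insert x U \ insert x s = U \ s := by
      ext y; simp only [Finset.mem_sdiff, Finset.mem_insert]; grind
    rw [this, Finset.card_insert_of_notMem hxs]
    ring
  · refine Finset.sum_congr rfl fun s hs => ?_
    have hxs : x ∉ s := fun h => hx (Finset.mem_powerset.1 hs h)
    rw [Finset.insert_sdiff_of_notMem _ hxs, Finset.card_insert_of_notMem (by simp [hx])]
    ring

lemma bernoulliSum_const (U : Finset ℕ) (p c : ℝ) : bernoulliSum U p (fun _ => c) = c := by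
  induction U using Finset.induction_on with
  | empty => simp [bernoulliSum]
  | insert x U hx ih => rw [bernoulliSum_insert hx, ih]; ring

lemma bernoulliSum_add (U : Finset ℕ) (p : ℝ) (g h : Finset ℕ → ℝ) :
    bernoulliSum U p (fun s => g s + h s) = bernoulliSum U p g + bernoulliSum U p h := by
  simp only [bernoulliSum, mul_add, Finset.sum_add_distrib]

lemma bernoulliSum_sub (U : Finset ℕ) (p : ℝ) (g h : Finset ℕ → ℝ) :
    bernoulliSum U p (fun s => g s - h s) = bernoulliSum U p g - bernoulliSum U p h := by
  simp only [bernoulliSum, mul_sub, Finset.sum_sub_distrib]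

lemma bernoulliSum_const_mul (U : Finset ℕ) (p c : ℝ) (g : Finset ℕ → ℝ) :
    bernoulliSum U p (fun s => c * g s) = c * bernoulliSum U p g := by
  simp only [bernoulliSum, Finset.mul_sum]
  exact Finset.sum_congr rfl fun s _ => by ring

lemma bernoulliSum_sum {ι : Type*} (U : Finset ℕ) (p : ℝ) (T : Finset ι)
    (g : ι → Finset ℕ → ℝ) :
    bernoulliSum U p (fun s => ∑ i ∈ T, g i s) = ∑ i ∈ T, bernoulliSum U p (g i) := by
  simp only [bernoulliSum, Finset.mul_sum]
  exact Finset.sum_comm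

lemma bernoulliSum_mono (U : Finset ℕ) {p : ℝ} (h0 : 0 ≤ p) (h1 : p ≤ 1)
    {g h : Finset ℕ → ℝ} (hgh : ∀ s, g s ≤ h s) : bernoulliSum U p g ≤ bernoulliSum U p h :=
  Finset.sum_le_sum fun s _ => mul_le_mul_of_nonneg_left (hgh s)
    (mul_nonneg (pow_nonneg h0 _) (pow_nonneg (sub_nonneg.2 h1) _))

lemma bernoulliSum_insert_of_invariant {U : Finset ℕ} {x : ℕ} (hx : x ∉ U) (p : ℝ)
    {g : Finset ℕ → ℝ} (hg : ∀ s, g (insert x s) = g s) :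
    bernoulliSum (insert x U) p g = bernoulliSum U p g := by
  simp only [bernoulliSum_insert hx, hg]
  ring

/-- The events `x ∈ s` and `x ∉ s` are independent of every function that ignores `x`. -/
lemma bernoulliSum_mem_mul {U : Finset ℕ} {x : ℕ} (hx : x ∈ U) (p : ℝ)
    {g : Finset ℕ → ℝ} (hg : ∀ s, g (insert x s) = g s) :
    bernoulliSum U p (fun s => (if x ∈ s then 1 else 0) * g s) = p * bernoulliSum U p g := by
  obtain ⟨V, hV, rfl⟩ : ∃ V, x ∉ V ∧ insert x V = U :=
    ⟨U.erase x, Finset.notMem_erase x U, Finset.insert_erase hx⟩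
  have h0 : bernoulliSum V p (fun s => (if x ∈ s then 1 else 0) * g s) = 0 := by
    refine Finset.sum_eq_zero fun s hs => ?_
    have : x ∉ s := fun h => hV (Finset.mem_powerset.1 hs h)
    simp [this]
  rw [bernoulliSum_insert_of_invariant hV p hg, bernoulliSum_insert hV, h0]
  simp [hg]

lemma bernoulliSum_notMem_mul {U : Finset ℕ} {x : ℕ} (hx : x ∈ U) (p : ℝ)
    {g : Finset ℕ → ℝ} (hg : ∀ s, g (insert x s) = g s) :
    bernoulliSum U p (fun s => (if x ∉ s then 1 else 0) * g s) = (1 - p) * bernoulliSum U p g := by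
  have : (fun s => (if x ∉ s then 1 else 0) * g s) =
      fun s => g s - (if x ∈ s then 1 else 0) * g s := by
    ext s; split_ifs <;> simp_all
  rw [this, bernoulliSum_sub, bernoulliSum_mem_mul hx p hg]
  ring

lemma bernoulliSum_disjoint_mul {U V : Finset ℕ} (hV : V ⊆ U) (p : ℝ) {g : Finset ℕ → ℝ}
    (hg : ∀ x ∈ V, ∀ s, g (insert x s) = g s) :
    bernoulliSum U p (fun s => (if Disjoint V s then 1 else 0) * g s) =
      (1 - p) ^ V.card * bernoulliSum U p g := by
  induction V using Finset.induction_on with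
  | empty => simp
  | insert x V hx ih =>
    have : (fun s => (if Disjoint (insert x V) s then 1 else 0) * g s) =
        fun s => (if x ∉ s then 1 else 0) * ((if Disjoint V s then 1 else 0) * g s) := by
      ext s; by_cases h : x ∈ s <;> simp [Finset.disjoint_insert_left, h]
    rw [this, bernoulliSum_notMem_mul (hV (Finset.mem_insert_self x V)),
      ih ((Finset.subset_insert x V).trans hV) fun y hy => hg y (Finset.mem_insert_of_mem hy),
      Finset.card_insert_of_notMem hx]
    · ring
    · intro s
      rw [hg x (Finset.mem_insert_self x V)]
      simp [Finset.disjoint_insert_right, hx]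

lemma bernoulliSum_pair_mul {U : Finset ℕ} {u v : ℕ} (hu : u ∈ U) (hv : v ∈ U) (huv : u ≠ v)
    (p : ℝ) {g : Finset ℕ → ℝ} (hgu : ∀ s, g (insert u s) = g s)
    (hgv : ∀ s, g (insert v s) = g s) :
    bernoulliSum U p (fun s => (if u ∈ s ∧ v ∈ s then 1 else 0) * g s) =
      p ^ 2 * bernoulliSum U p g := by
  have : (fun s => (if u ∈ s ∧ v ∈ s then 1 else 0) * g s) =
      fun s => (if u ∈ s then 1 else 0) * ((if v ∈ s then 1 else 0) * g s) := by
    ext s; by_cases h : u ∈ s <;> simp [h]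
  rw [this, bernoulliSum_mem_mul hu, bernoulliSum_mem_mul hv p hgv]
  · ring
  · intro s
    simp [hgu, huv.symm]

/-! ### Sets that avoid a family of pairs -/

/-- The indicator of the event that `s` contains no pair of `F`, that is, that `s` is independent in
the graph with edge set `F`. -/
def edgeFree (F : Finset (ℕ × ℕ)) (s : Finset ℕ) : ℝ :=
  if ∀ e ∈ F, ¬(e.1 ∈ s ∧ e.2 ∈ s) then 1 else 0

lemma edgeFree_nonneg (F : Finset (ℕ × ℕ)) (s : Finset ℕ) : 0 ≤ edgeFree F s := by
  unfold edgeFree; split_ifs <;> simp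

lemma edgeFree_empty (s : Finset ℕ) : edgeFree ∅ s = 1 := by simp [edgeFree]

lemma edgeFree_insert (e : ℕ × ℕ) (F : Finset (ℕ × ℕ)) (s : Finset ℕ) :
    edgeFree (insert e F) s =
      edgeFree F s - (if e.1 ∈ s ∧ e.2 ∈ s then 1 else 0) * edgeFree F s := by
  unfold edgeFree
  simp only [Finset.forall_mem_insert]
  split_ifs <;> first | tauto | norm_num

lemma edgeFree_insert_vertex {F : Finset (ℕ × ℕ)} {x : ℕ} (hx : ∀ e ∈ F, e.1 ≠ x ∧ e.2 ≠ x)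
    (s : Finset ℕ) : edgeFree F (insert x s) = edgeFree F s := by
  unfold edgeFree
  congr 1
  refine propext (forall₂_congr fun e he => ?_)
  simp [hx e he]

/-- For pairwise disjoint edges that also miss the coordinates on which `h` depends, avoiding the
edges are independent events. -/
lemma bernoulliSum_edgeFree_of_disjoint {U : Finset ℕ} (p : ℝ) {F : Finset (ℕ × ℕ)} {n : ℕ}
    (hF : ∀ e ∈ F, e.1 < e.2 ∧ e.1 + e.2 = n ∧ e.1 ∈ U ∧ e.2 ∈ U) {h : Finset ℕ → ℝ}
    (hh : ∀ e ∈ F, ∀ s, h (insert e.1 s) = h s ∧ h (insert e.2 s) = h s) :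
    bernoulliSum U p (fun s => edgeFree F s * h s) =
      (1 - p ^ 2) ^ F.card * bernoulliSum U p h := by
  induction F using Finset.induction_on with
  | empty => simp [edgeFree_empty]
  | insert e F he ih =>
    have hFe := hF e (Finset.mem_insert_self e F)
    have hhe := hh e (Finset.mem_insert_self e F)
    have key : ∀ f ∈ F, (f.1 ≠ e.1 ∧ f.2 ≠ e.1) ∧ (f.1 ≠ e.2 ∧ f.2 ≠ e.2) := by
      intro f hf
      have h1 := hF f (Finset.mem_insert_of_mem hf)
      have h2 : f ≠ e := fun h => he (h ▸ hf)
      have h3 : f.1 ≠ e.1 := fun h => h2 (Prod.ext h (by omega))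
      omega
    have : (fun s => edgeFree (insert e F) s * h s) = fun s => edgeFree F s * h s -
        (if e.1 ∈ s ∧ e.2 ∈ s then 1 else 0) * (edgeFree F s * h s) := by
      ext s; rw [edgeFree_insert]; ring
    rw [this, bernoulliSum_sub, bernoulliSum_pair_mul hFe.2.2.1 hFe.2.2.2 hFe.1.ne,
      ih (fun f hf => hF f (Finset.mem_insert_of_mem hf))
        (fun f hf => hh f (Finset.mem_insert_of_mem hf)), Finset.card_insert_of_notMem he]
    · ring
    · intro s
      rw [(hhe s).1, edgeFree_insert_vertex fun f hf => (key f hf).1]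
    · intro s
      rw [(hhe s).2, edgeFree_insert_vertex fun f hf => (key f hf).2]

/-- Adding an edge `{u, v}` whose adjacent edges in `F` are all met by a set `V` of at most two
further vertices multiplies the probability of being edge-free by at most `1 - p² (1 - p)²`.
Deleting `u`, `v` and `V` from `s` cannot destroy edge-freeness and makes the event independent of
these coordinates; when moreover `u, v ∈ s` and `V` is disjoint from `s`, edge-freeness of the
smaller set gives that of `s`. -/
lemma bernoulliSum_edgeFree_insert_le {U V : Finset ℕ} {p : ℝ} (h0 : 0 ≤ p) (h1 : p ≤ 1)
    {F : Finset (ℕ × ℕ)} {u v : ℕ} (huv : u ≠ v) (hu : u ∈ U) (hv : v ∈ U) (hV : V ⊆ U)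
    (hV2 : V.card ≤ 2) (huV : u ∉ V) (hvV : v ∉ V)
    (hF : ∀ f ∈ F, (f.1 = u ∨ f.1 = v ∨ f.2 = u ∨ f.2 = v) → f.1 ∈ V ∨ f.2 ∈ V) :
    bernoulliSum U p (edgeFree (insert (u, v) F)) ≤
      (1 - p ^ 2 * (1 - p) ^ 2) * bernoulliSum U p (edgeFree F) := by
  have hq : 0 ≤ 1 - p := sub_nonneg.2 h1
  set S : Finset ℕ := insert u (insert v V) with hS
  set g : Finset ℕ → ℝ := fun s => edgeFree F (s \ S) with hg
  have hginv : ∀ x ∈ S, ∀ s, g (insert x s) = g s := by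
    intro x hx s
    simp only [hg]
    rw [Finset.insert_sdiff_of_mem _ hx]
  have hle : ∀ s, edgeFree F s ≤ g s := by
    intro s
    simp only [hg, edgeFree]
    split_ifs with ha hb
    · exact le_rfl
    · exact absurd (fun e he h => ha e he
        ⟨(Finset.mem_sdiff.1 h.1).1, (Finset.mem_sdiff.1 h.2).1⟩) hb
    · exact zero_le_one
    · exact le_rfl
  have hpair : bernoulliSum U p (fun s => (if u ∈ s ∧ v ∈ s then 1 else 0) *
      ((if Disjoint V s then 1 else 0) * g s)) =
      p ^ 2 * ((1 - p) ^ V.card * bernoulliSum U p g) := by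
    rw [bernoulliSum_pair_mul hu hv huv, bernoulliSum_disjoint_mul hV]
    · exact fun x hx => hginv x (by simp [hS, hx])
    · intro s
      rw [hginv u (by simp [hS])]
      simp [Finset.disjoint_insert_right, huV]
    · intro s
      rw [hginv v (by simp [hS])]
      simp [Finset.disjoint_insert_right, hvV]
  have hlow : bernoulliSum U p (fun s => (if u ∈ s ∧ v ∈ s then 1 else 0) *
      ((if Disjoint V s then 1 else 0) * g s)) ≤
      bernoulliSum U p (fun s => (if u ∈ s ∧ v ∈ s then 1 else 0) * edgeFree F s) := by
    refine bernoulliSum_mono U h0 h1 fun s => mul_le_mul_of_nonneg_left ?_ (by split_ifs <;> simp)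
    by_cases hd : Disjoint V s
    · rw [if_pos hd, one_mul]
      simp only [hg, edgeFree]
      split_ifs with ha hb
      · exact le_rfl
      · refine absurd (fun e he h => ?_) hb
        have hd1 : ∀ x ∈ s, x ∉ V := fun x hx hx' => Finset.disjoint_left.1 hd hx' hx
        have hnot : ¬(e.1 = u ∨ e.1 = v ∨ e.2 = u ∨ e.2 = v) := fun h' =>
          (hF e he h').elim (hd1 _ h.1) (hd1 _ h.2)
        have h1' := hd1 _ h.1
        have h2' := hd1 _ h.2
        refine ha e he ⟨Finset.mem_sdiff.2 ⟨h.1, ?_⟩, Finset.mem_sdiff.2 ⟨h.2, ?_⟩⟩ <;>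
          simp only [hS, Finset.mem_insert] <;> tauto
      · exact zero_le_one
      · exact le_rfl
    · rw [if_neg hd, zero_mul]
      exact edgeFree_nonneg F s
  have hmono := bernoulliSum_mono U h0 h1 hle
  have hF0 : 0 ≤ bernoulliSum U p (edgeFree F) := by
    simpa [bernoulliSum_const] using bernoulliSum_mono U h0 h1 (edgeFree_nonneg F)
  have hpow : (1 - p) ^ 2 ≤ (1 - p) ^ V.card :=
    pow_le_pow_of_le_one hq (by linarith) hV2
  have hsub : bernoulliSum U p (edgeFree (insert (u, v) F)) = bernoulliSum U p (edgeFree F) -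
      bernoulliSum U p (fun s => (if u ∈ s ∧ v ∈ s then 1 else 0) * edgeFree F s) := by
    rw [← bernoulliSum_sub]
    congr 1
    ext s
    exact edgeFree_insert (u, v) F s
  have hprod : (1 - p) ^ 2 * bernoulliSum U p (edgeFree F) ≤
      (1 - p) ^ V.card * bernoulliSum U p g :=
    mul_le_mul hpow hmono hF0 (pow_nonneg hq _)
  have := mul_le_mul_of_nonneg_left hprod (sq_nonneg p)
  rw [hsub]
  linarith

/-- Pairs with sum `m` or `n` form a graph of maximum degree two, so that each of them costs a
factor of at most `1 - p² (1 - p)²`. -/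
lemma bernoulliSum_edgeFree_le {U : Finset ℕ} {p : ℝ} (h0 : 0 ≤ p) (h1 : p ≤ 1)
    {F : Finset (ℕ × ℕ)} {m n : ℕ} (hm : Finset.range (m + 1) ⊆ U)
    (hn : Finset.range (n + 1) ⊆ U)
    (hF : ∀ e ∈ F, e.1 < e.2 ∧ (e.1 + e.2 = m ∨ e.1 + e.2 = n)) :
    bernoulliSum U p (edgeFree F) ≤ (1 - p ^ 2 * (1 - p) ^ 2) ^ F.card := by
  have hr : 0 ≤ 1 - p ^ 2 * (1 - p) ^ 2 := by
    have := pow_le_one₀ (n := 2) (mul_nonneg h0 (sub_nonneg.2 h1))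
      (mul_le_one₀ h1 (sub_nonneg.2 h1) (by linarith))
    rw [mul_pow] at this
    linarith
  induction F using Finset.induction_on with
  | empty =>
    have : edgeFree ∅ = fun _ => 1 := funext edgeFree_empty
    simp [this, bernoulliSum_const]
  | insert e F he ih =>
    obtain ⟨u, v⟩ := e
    obtain ⟨huv, hs⟩ := hF _ (Finset.mem_insert_self _ F)
    simp only at huv hs
    have hF' : ∀ f ∈ F, f.1 < f.2 ∧ (f.1 + f.2 = m ∨ f.1 + f.2 = n) :=
      fun f hf => hF f (Finset.mem_insert_of_mem hf)
    -- An edge of `F` adjacent to `{u, v}` has the other sum `k`, hence meets `{k - u, k - v}`.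
    obtain ⟨k, hk, hadj⟩ : ∃ k, Finset.range (k + 1) ⊆ U ∧
        ∀ f ∈ F, (f.1 = u ∨ f.1 = v ∨ f.2 = u ∨ f.2 = v) → f.1 + f.2 = k ∧ k ≠ u + v := by
      have hne : ∀ f ∈ F, (f.1 = u ∨ f.1 = v ∨ f.2 = u ∨ f.2 = v) → f.1 + f.2 ≠ u + v := by
        intro f hf hfu hsum
        have := (hF' f hf).1
        exact he ((Prod.ext (by simp only; omega) (by simp only; omega) : f = (u, v)) ▸ hf)
      rcases hs with hs | hs
      · refine ⟨n, hn, fun f hf hfu => ?_⟩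
        have := hne f hf hfu
        have := (hF' f hf).2
        omega
      · refine ⟨m, hm, fun f hf hfu => ?_⟩
        have := hne f hf hfu
        have := (hF' f hf).2
        omega
    have hU : ∀ x, x ≤ u + v → x ∈ U := fun x hx => by
      rcases hs with hs | hs
      · exact hm (Finset.mem_range.2 (by omega))
      · exact hn (Finset.mem_range.2 (by omega))
    refine (bernoulliSum_edgeFree_insert_le (V := ({k - u, k - v} : Finset ℕ) \ {u, v}) h0 h1
      huv.ne (hU u (by omega)) (hU v (by omega)) ?_ ?_ (by simp) (by simp) ?_).trans ?_
    · intro x hx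
      simp only [Finset.mem_sdiff, Finset.mem_insert, Finset.mem_singleton] at hx
      exact hk (Finset.mem_range.2 (by omega))
    · exact (Finset.card_le_card Finset.sdiff_subset).trans Finset.card_le_two
    · intro f hf hfu
      have := hadj f hf hfu
      have := (hF' f hf).1
      simp only [Finset.mem_sdiff, Finset.mem_insert, Finset.mem_singleton]
      omega
    · rw [Finset.card_insert_of_notMem he, pow_succ' _ F.card]
      exact mul_le_mul_of_nonneg_left (ih hF') hr

/-! ### Integers missing from the sumset -/

/-- The pairs `(a, b)` with `a < b` and `a + b = n`. -/
def sumPairs (n : ℕ) : Finset (ℕ × ℕ) :=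
  (Finset.HasAntidiagonal.antidiagonal n).filter fun e => e.1 < e.2

lemma mem_sumPairs {n : ℕ} {e : ℕ × ℕ} : e ∈ sumPairs n ↔ e.1 + e.2 = n ∧ e.1 < e.2 := by
  simp [sumPairs]

lemma card_sumPairs (n : ℕ) : (sumPairs n).card = (n + 1) / 2 := by
  have : sumPairs n = (Finset.range ((n + 1) / 2)).image fun a => (a, n - a) := by
    ext ⟨a, b⟩
    simp only [mem_sumPairs, Finset.mem_image, Finset.mem_range, Prod.mk.injEq]
    constructor
    · exact fun h => ⟨a, by omega, rfl, by omega⟩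
    · rintro ⟨a, h, rfl, rfl⟩
      omega
  rw [this, Finset.card_image_of_injective _ fun a b h => (Prod.ext_iff.1 h).1, Finset.card_range]

/-- The indicator of the event `n ∉ s + s`. -/
def missing (n : ℕ) (s : Finset ℕ) : ℝ := if n ∉ s + s then 1 else 0

lemma missing_nonneg (n : ℕ) (s : Finset ℕ) : 0 ≤ missing n s := by
  unfold missing; split_ifs <;> simp

lemma missing_insert {n x : ℕ} (hx : n < x) (s : Finset ℕ) :
    missing n (insert x s) = missing n s := by
  unfold missing
  congr 2
  refine propext ⟨fun h => ?_, fun h => Finset.add_subset_add (Finset.subset_insert _ _)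
    (Finset.subset_insert _ _) h⟩
  obtain ⟨a, ha, b, hb, rfl⟩ := Finset.mem_add.1 h
  refine Finset.add_mem_add (Finset.mem_of_mem_insert_of_ne ha ?_)
    (Finset.mem_of_mem_insert_of_ne hb ?_) <;> omega

lemma missing_eq (n : ℕ) (s : Finset ℕ) :
    missing n s = edgeFree (sumPairs n) s * if Even n ∧ n / 2 ∈ s then 0 else 1 := by
  have : n ∉ s + s ↔ (∀ e ∈ sumPairs n, ¬(e.1 ∈ s ∧ e.2 ∈ s)) ∧ ¬(Even n ∧ n / 2 ∈ s) := by
    constructor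
    · refine fun h => ⟨fun e he hs => h ?_, fun hs => h ?_⟩
      · exact (mem_sumPairs.1 he).1 ▸ Finset.add_mem_add hs.1 hs.2
      · obtain ⟨k, rfl⟩ := hs.1
        have hk : (k + k) / 2 = k := by omega
        exact Finset.add_mem_add (hk ▸ hs.2) (hk ▸ hs.2)
    · rintro ⟨h, h2⟩ hs
      obtain ⟨a, ha, b, hb, hab⟩ := Finset.mem_add.1 hs
      rcases lt_trichotomy a b with hlt | rfl | hlt
      · exact h (a, b) (mem_sumPairs.2 ⟨hab, hlt⟩) ⟨ha, hb⟩
      · exact h2 ⟨⟨a, hab.symm⟩, by rwa [show n / 2 = a by omega]⟩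
      · exact h (b, a) (mem_sumPairs.2 ⟨by simp only; omega, hlt⟩) ⟨hb, ha⟩
  unfold missing edgeFree
  simp only [this]
  split_ifs <;> first | tauto | norm_num

/-- The probability that `n` is missing from the sumset: `n` has `(n + 1) / 2` representations as a
sum of two distinct numbers and, if it is even, one as a double. -/
noncomputable def missingProb (p : ℝ) (n : ℕ) : ℝ :=
  (1 - p ^ 2) ^ ((n + 1) / 2) * if Even n then 1 - p else 1

lemma bernoulliSum_missing {U : Finset ℕ} (p : ℝ) {n : ℕ} (hU : Finset.range (n + 1) ⊆ U) :
    bernoulliSum U p (missing n) = missingProb p n := by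
  have hmem : ∀ x, x ≤ n → x ∈ U := fun x hx => hU (Finset.mem_range.2 (by omega))
  have heq : missing n = fun s => edgeFree (sumPairs n) s *
      if Even n ∧ n / 2 ∈ s then 0 else 1 := funext (missing_eq n)
  rw [heq, bernoulliSum_edgeFree_of_disjoint p (n := n), card_sumPairs, missingProb]
  · congr 1
    by_cases h : Even n
    · have := bernoulliSum_notMem_mul (hmem (n / 2) (by omega)) p (g := fun _ => 1) fun _ => rfl
      rw [bernoulliSum_const, mul_one] at this
      rw [if_pos h, ← this]
      congr 1
      ext s
      simp [h]
    · simp [h, bernoulliSum_const]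
  · intro e he
    have := mem_sumPairs.1 he
    exact ⟨this.2, this.1, hmem _ (by omega), hmem _ (by omega)⟩
  · intro e he s
    have := mem_sumPairs.1 he
    by_cases h : Even n
    · obtain ⟨k, hk⟩ := h
      simp only [Finset.mem_insert, show n / 2 ≠ e.1 by omega, show n / 2 ≠ e.2 by omega, false_or,
        and_self]
    · simp [h]

lemma bernoulliSum_missing_mul_le {U : Finset ℕ} {p : ℝ} (h0 : 0 ≤ p) (h1 : p ≤ 1) {m n : ℕ}
    (hmn : m ≠ n) (hm : Finset.range (m + 1) ⊆ U) (hn : Finset.range (n + 1) ⊆ U) :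
    bernoulliSum U p (fun s => missing m s * missing n s) ≤
      (1 - p ^ 2 * (1 - p) ^ 2) ^ ((m + 1) / 2) * (1 - p ^ 2 * (1 - p) ^ 2) ^ ((n + 1) / 2) := by
  have hdisj : Disjoint (sumPairs m) (sumPairs n) := Finset.disjoint_left.2 fun e he he' =>
    hmn ((mem_sumPairs.1 he).1.symm.trans (mem_sumPairs.1 he').1)
  rw [← pow_add, ← card_sumPairs m, ← card_sumPairs n, ← Finset.card_union_of_disjoint hdisj]
  refine (bernoulliSum_mono U h0 h1 fun s => ?_).trans
    (bernoulliSum_edgeFree_le h0 h1 hm hn fun e he => ?_)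
  · simp only [missing_eq, edgeFree, Finset.mem_union, or_imp, forall_and]
    split_ifs <;> first | tauto | norm_num
  · rcases Finset.mem_union.1 he with he | he <;> have := mem_sumPairs.1 he <;> tauto

/-- The number of integers at most `N` missing from `s + s`, as a sum of indicators. -/
def missingCount (N : ℕ) (s : Finset ℕ) : ℝ := ∑ n ∈ Finset.range (N + 1), missing n s

lemma leftMissing_coe (N : ℕ) (s : Finset ℕ) :
    (leftMissing N (s : Set ℕ) : ℝ) = missingCount N s := by
  have : {n : ℕ | n ≤ N ∧ n ∉ (s : Set ℕ) + s} =
      ((Finset.range (N + 1)).filter fun n => n ∉ s + s : Finset ℕ) := by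
    ext n
    simp [← Finset.coe_add]
  rw [leftMissing, this, Set.ncard_coe_finset, missingCount]
  simp [missing, Finset.card_filter]

lemma missingCount_nonneg (N : ℕ) (s : Finset ℕ) : 0 ≤ missingCount N s :=
  Finset.sum_nonneg fun n _ => missing_nonneg n s

lemma bernoulliSum_missingCount (N : ℕ) (p : ℝ) :
    bernoulliSum (Finset.range (N + 1)) p (missingCount N) =
      ∑ n ∈ Finset.range (N + 1), missingProb p n := by
  unfold missingCount
  rw [bernoulliSum_sum]
  refine Finset.sum_congr rfl fun n hn => bernoulliSum_missing p (Finset.range_mono ?_)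
  have := Finset.mem_range.1 hn
  omega

lemma bernoulliSum_missingCount_sq_mono {p : ℝ} (h0 : 0 ≤ p) (h1 : p ≤ 1) :
    Monotone fun N : ℕ =>
      bernoulliSum (Finset.range (N + 1)) p (fun s => missingCount N s ^ 2) := by
  refine monotone_nat_of_le_succ fun N => ?_
  rw [← bernoulliSum_insert_of_invariant (x := N + 1) (by simp), ← Finset.range_add_one]
  · refine bernoulliSum_mono _ h0 h1 fun s => pow_le_pow_left₀ (missingCount_nonneg N s) ?_ 2
    rw [missingCount, missingCount, Finset.sum_range_succ _ (N + 1)]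
    exact le_add_of_nonneg_right (missing_nonneg _ s)
  · intro s
    congr 1
    exact Finset.sum_congr rfl fun n hn => missing_insert (Finset.mem_range.1 hn) s

/-- The diagonal terms of the second moment sum to the mean; the others are bounded by the product
`r ^ ((m + 1) / 2) * r ^ ((n + 1) / 2)` with `r = 1 - p² (1 - p)²`. -/
lemma bernoulliSum_missingCount_sq_le {p : ℝ} (h0 : 0 ≤ p) (h1 : p ≤ 1) (N : ℕ) :
    bernoulliSum (Finset.range (N + 1)) p (fun s => missingCount N s ^ 2) ≤
      ∑ n ∈ Finset.range (N + 1), missingProb p n +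
        (∑ n ∈ Finset.range (N + 1), (1 - p ^ 2 * (1 - p) ^ 2) ^ ((n + 1) / 2)) ^ 2 := by
  have hr : 0 ≤ 1 - p ^ 2 * (1 - p) ^ 2 := by
    have h := pow_le_one₀ (n := 2) (mul_nonneg h0 (sub_nonneg.2 h1))
      (mul_le_one₀ h1 (sub_nonneg.2 h1) (by linarith))
    rw [mul_pow] at h
    linarith
  have hsub : ∀ n ∈ Finset.range (N + 1), Finset.range (n + 1) ⊆ Finset.range (N + 1) := by
    intro n hn
    have := Finset.mem_range.1 hn
    exact Finset.range_mono (by omega)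
  simp only [missingCount, pow_two (∑ n ∈ Finset.range (N + 1), missing n _), Finset.sum_mul_sum,
    bernoulliSum_sum]
  rw [pow_two, Finset.sum_mul_sum, ← Finset.sum_add_distrib]
  refine Finset.sum_le_sum fun m hm => ?_
  have hdiag : missingProb p m =
      ∑ n ∈ Finset.range (N + 1), if n = m then missingProb p m else 0 := by
    rw [Finset.sum_ite_eq' _ _ fun _ => missingProb p m, if_pos hm]
  rw [hdiag, ← Finset.sum_add_distrib]
  refine Finset.sum_le_sum fun n hn => ?_
  split_ifs with h
  · subst h
    rw [← bernoulliSum_missing p (hsub n hn)]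
    have : (fun s => missing n s * missing n s) = missing n := by
      ext s; unfold missing; split_ifs <;> simp
    rw [this]
    exact le_add_of_nonneg_right (mul_nonneg (pow_nonneg hr _) (pow_nonneg hr _))
  · rw [zero_add]
    exact bernoulliSum_missing_mul_le h0 h1 (Ne.symm h) (hsub m hm) (hsub n hn)

/-! ### Summing over all integers -/

lemma hasSum_pow_succ_div_two {r : ℝ} (h0 : 0 ≤ r) (h1 : r < 1) (c : ℝ) :
    HasSum (fun n : ℕ => r ^ ((n + 1) / 2) * if Even n then c else 1) ((c + r) / (1 - r)) := by
  have hg := hasSum_geometric_of_lt_one h0 h1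
  have he : (c + r) / (1 - r) = (1 - r)⁻¹ * c + (1 - r)⁻¹ * r := by
    rw [div_eq_mul_inv]; ring
  rw [he]
  refine HasSum.even_add_odd ?_ ?_
  · refine (congrArg (HasSum · _) (funext fun k => ?_)).mpr (hg.mul_right c)
    rw [if_pos (even_two_mul k), show (2 * k + 1) / 2 = k by omega]
  · refine (congrArg (HasSum · _) (funext fun k => ?_)).mpr (hg.mul_right r)
    rw [if_neg (by simp), show (2 * k + 1 + 1) / 2 = k + 1 by omega, pow_succ, mul_one]

lemma missingProb_nonneg {p : ℝ} (h0 : 0 ≤ p) (h1 : p ≤ 1) (n : ℕ) : 0 ≤ missingProb p n := by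
  have : p ^ 2 ≤ 1 := pow_le_one₀ h0 h1
  refine mul_nonneg (pow_nonneg (by linarith) _) ?_
  split_ifs <;> linarith

lemma hasSum_missingProb {p : ℝ} (h0 : 0 < p) (h1 : p < 1) :
    HasSum (missingProb p) (2 / p ^ 2 - 1 / p - 1) := by
  have h : p ^ 2 < 1 := pow_lt_one₀ h0.le h1 two_ne_zero
  have h2 : 0 < p ^ 2 := by positivity
  have he : 2 / p ^ 2 - 1 / p - 1 = (1 - p + (1 - p ^ 2)) / (1 - (1 - p ^ 2)) := by
    rw [sub_sub_cancel]
    field_simp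
    ring
  rw [he]
  exact hasSum_pow_succ_div_two (by linarith) (by linarith) (1 - p)

lemma bernoulliSum_missingCount_sq_le_limit {p : ℝ} (h0 : 0 < p) (h1 : p < 1) (N : ℕ) :
    bernoulliSum (Finset.range (N + 1)) p (fun s => missingCount N s ^ 2) ≤
      (2 / p ^ 2 - 1 / p - 1) + (2 / (p ^ 2 * (1 - p) ^ 2)) ^ 2 := by
  have hq : 0 < 1 - p := sub_pos.2 h1
  have hpos : 0 < p ^ 2 * (1 - p) ^ 2 := by positivity
  have hle : p ^ 2 * (1 - p) ^ 2 ≤ 1 := by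
    rw [← mul_pow]
    exact pow_le_one₀ (by positivity) (mul_le_one₀ h1.le hq.le (by linarith))
  have hs := hasSum_pow_succ_div_two (r := 1 - p ^ 2 * (1 - p) ^ 2) (by linarith) (by linarith) 1
  simp only [ite_self, mul_one, sub_sub_cancel] at hs
  refine (bernoulliSum_missingCount_sq_le h0.le h1.le N).trans (add_le_add ?_ ?_)
  · exact sum_le_hasSum _ (fun n _ => missingProb_nonneg h0.le h1.le n) (hasSum_missingProb h0 h1)
  · refine pow_le_pow_left₀ (Finset.sum_nonneg fun n _ => pow_nonneg (by linarith) _) ?_ 2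
    refine (sum_le_hasSum _ (fun n _ => pow_nonneg (by linarith) _) hs).trans ?_
    gcongr
    linarith

lemma sq_bernoulliSum_le (U : Finset ℕ) {p : ℝ} (h0 : 0 ≤ p) (h1 : p ≤ 1) (g : Finset ℕ → ℝ) :
    bernoulliSum U p g ^ 2 ≤ bernoulliSum U p (fun s => g s ^ 2) := by
  set μ := bernoulliSum U p g with hμ
  have h := bernoulliSum_mono U h0 h1 (g := fun _ => 0)
    (h := fun s => (g s ^ 2 - 2 * μ * g s) + μ ^ 2) fun s => by nlinarith [sq_nonneg (g s - μ)]
  rw [bernoulliSum_const, bernoulliSum_add, bernoulliSum_sub, bernoulliSum_const_mul,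
    bernoulliSum_const, ← hμ] at h
  linarith

/-- Chebyshev's inequality. -/
lemma bernoulliSum_deviation_le (U : Finset ℕ) {p : ℝ} (h0 : 0 ≤ p) (h1 : p ≤ 1)
    (g : Finset ℕ → ℝ) (hg : bernoulliSum U p g ≠ 0) {ε : ℝ} (hε : 0 < ε) :
    bernoulliSum U p (fun s => if ε ≤ |g s / bernoulliSum U p g - 1| then 1 else 0) ≤
      (bernoulliSum U p (fun s => g s ^ 2) - bernoulliSum U p g ^ 2) /
        bernoulliSum U p g ^ 2 / ε ^ 2 := by
  set μ := bernoulliSum U p g with hμ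
  -- The indicator is at most `(g s / μ - 1) ^ 2 / ε ^ 2`, expanded here into powers of `g s`.
  have h := bernoulliSum_mono U h0 h1
    (g := fun s => if ε ≤ |g s / μ - 1| then 1 else 0)
    (h := fun s => ((1 / (μ ^ 2 * ε ^ 2)) * g s ^ 2 - 2 / (μ * ε ^ 2) * g s) + 1 / ε ^ 2)
    fun s => by
      have he : ((1 / (μ ^ 2 * ε ^ 2)) * g s ^ 2 - 2 / (μ * ε ^ 2) * g s) + 1 / ε ^ 2 =
          (g s / μ - 1) ^ 2 / ε ^ 2 := by
        field_simp
        ring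
      simp only [he]
      split_ifs with hc
      · rw [le_div_iff₀ (by positivity), one_mul, ← sq_abs (g s / μ - 1)]
        exact pow_le_pow_left₀ hε.le hc 2
      · positivity
  rw [bernoulliSum_add, bernoulliSum_sub, bernoulliSum_const_mul, bernoulliSum_const_mul,
    bernoulliSum_const, ← hμ] at h
  refine h.trans (le_of_eq ?_)
  field_simp
  ring

/-! ### The measure `randomSubset` as a finite sum -/

lemma randomSubset_real_singleton (N : ℕ) (p : I) {s : Finset ℕ} (hs : s ⊆ Finset.range (N + 1)) :
    (randomSubset N p).real {(s : Set ℕ)} =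
      (p : ℝ) ^ s.card * (1 - p : ℝ) ^ (Finset.range (N + 1) \ s).card := by
  have hI : Set.Iic N = (Finset.range (N + 1) : Set ℕ) := by
    ext n; simp
  rw [randomSubset, hI, setBernoulli_real_singleton p (by exact_mod_cast hs)
    (Finset.finite_toSet _), Set.ncard_coe_finset, ← Finset.coe_sdiff, Set.ncard_coe_finset]

lemma ae_mem_image_powerset (N : ℕ) (p : I) : ∀ᵐ A ∂randomSubset N p,
    A ∈ (((Finset.range (N + 1)).powerset.map ⟨_, Finset.coe_injective⟩ : Finset (Set ℕ)) :
      Set (Set ℕ)) := by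
  filter_upwards [setBernoulli_ae_subset (u := Set.Iic N) (p := p)] with A hA
  have hfin : A.Finite := (Set.finite_Iic N).subset hA
  simp only [Finset.coe_map, Function.Embedding.coeFn_mk, Set.mem_image, Finset.mem_coe,
    Finset.mem_powerset]
  refine ⟨hfin.toFinset, fun n hn => ?_, hfin.coe_toFinset⟩
  have : n ≤ N := hA (hfin.mem_toFinset.1 hn)
  exact Finset.mem_range.2 (by omega)

lemma integral_randomSubset (N : ℕ) (p : I) (f : Set ℕ → ℝ) :
    ∫ A, f A ∂randomSubset N p =
      bernoulliSum (Finset.range (N + 1)) p (fun s => f (s : Set ℕ)) := by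
  have : IsProbabilityMeasure (randomSubset N p) := by unfold randomSubset; infer_instance
  rw [← Measure.restrict_eq_self_of_ae_mem (ae_mem_image_powerset N p),
    setIntegral_finset _ IntegrableOn.finset, Finset.sum_map, bernoulliSum]
  refine Finset.sum_congr rfl fun s hs => ?_
  rw [Function.Embedding.coeFn_mk, randomSubset_real_singleton N p (Finset.mem_powerset.1 hs),
    smul_eq_mul]

open scoped Classical in
lemma randomSubset_real_eq (N : ℕ) (p : I) (S : Set (Set ℕ)) :
    (randomSubset N p).real S =
      bernoulliSum (Finset.range (N + 1)) p (fun s => if (s : Set ℕ) ∈ S then 1 else 0) := by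
  have : IsProbabilityMeasure (randomSubset N p) := by unfold randomSubset; infer_instance
  set T := (Finset.range (N + 1)).powerset.map
    (⟨_, Finset.coe_injective⟩ : Finset ℕ ↪ Set ℕ) with hT
  -- Up to a null set `S` is finite, hence measurable.
  have hfin : (S ∩ T : Set (Set ℕ)).Finite := T.finite_toSet.subset Set.inter_subset_right
  have hae : (S : Set (Set ℕ)) =ᵐ[randomSubset N p] (S ∩ T : Set (Set ℕ)) := by
    filter_upwards [ae_mem_image_powerset N p] with A hA
    exact propext ⟨fun h => ⟨h, hA⟩, fun h => h.1⟩
  rw [measureReal_congr hae, ← integral_indicator_one hfin.measurableSet, integral_randomSubset]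
  unfold bernoulliSum
  refine Finset.sum_congr rfl fun s hs => ?_
  have : (s : Set ℕ) ∈ (T : Set (Set ℕ)) :=
    Finset.mem_coe.2 (Finset.mem_map_of_mem (⟨_, Finset.coe_injective⟩ : Finset ℕ ↪ Set ℕ) hs)
  simp [Set.indicator_apply, this]

lemma meanY_eq (N : ℕ) (p : I) :
    meanY N p = bernoulliSum (Finset.range (N + 1)) p (missingCount N) := by
  simp only [meanY, integral_randomSubset, leftMissing_coe]

lemma secondMomentY_eq (N : ℕ) (p : I) :
    secondMomentY N p =
      bernoulliSum (Finset.range (N + 1)) p (fun s => missingCount N s ^ 2) := by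
  simp only [secondMomentY, integral_randomSubset, leftMissing_coe]

lemma tendsto_meanY {p : I} (h0 : 0 < p) (h1 : p < 1) :
    Tendsto (fun N : ℕ => meanY N p) atTop (𝓝 (2 / (p : ℝ) ^ 2 - 1 / (p : ℝ) - 1)) := by
  simp only [meanY_eq, bernoulliSum_missingCount]
  exact (hasSum_missingProb (p := (p : ℝ)) (by exact_mod_cast h0)
    (by exact_mod_cast h1)).tendsto_sum_nat.comp (tendsto_add_atTop_nat 1)

lemma tendsto_secondMomentY {p : I} (h0 : 0 < p) (h1 : p < 1) :
    Tendsto (fun N : ℕ => secondMomentY N p) atTop (𝓝 (⨆ N, secondMomentY N p)) := by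
  simp only [secondMomentY_eq]
  exact tendsto_atTop_ciSup (bernoulliSum_missingCount_sq_mono p.2.1 p.2.2)
    ⟨_, Set.forall_mem_range.2 (bernoulliSum_missingCount_sq_le_limit (by exact_mod_cast h0)
      (by exact_mod_cast h1))⟩

/-! ### Asymptotics as `p → 0` -/

lemma tendsto_coe_unitInterval : Tendsto (fun p : I => (p : ℝ)) (𝓝[>] 0) (𝓝 0) :=
  (continuous_subtype_val.tendsto' (0 : I) 0 rfl).mono_left nhdsWithin_le_nhds

lemma eventually_unitInterval : ∀ᶠ p : I in 𝓝[>] 0, 0 < p ∧ p < 1 :=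
  eventually_mem_nhdsWithin.and
    (nhdsWithin_le_nhds (Iio_mem_nhds (zero_lt_one : (0 : I) < 1)))

lemma two_div_sq_sub_pos {p : ℝ} (h0 : 0 < p) (h1 : p < 1) : 0 < 2 / p ^ 2 - 1 / p - 1 := by
  have : 2 / p ^ 2 - 1 / p - 1 = (1 - p) * (2 + p) / p ^ 2 := by
    field_simp
    ring
  rw [this]
  have : 0 < 1 - p := sub_pos.2 h1
  positivity

lemma tendsto_sq_mean_mul : Tendsto
    (fun p : I => (p : ℝ) ^ 4 * (2 / (p : ℝ) ^ 2 - 1 / (p : ℝ) - 1) ^ 2 / 4) (𝓝[>] 0) (𝓝 1) := by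
  have hc : Continuous fun x : ℝ => (2 - x - x ^ 2) ^ 2 / 4 := by fun_prop
  have h := (hc.tendsto' 0 1 (by norm_num)).comp tendsto_coe_unitInterval
  refine h.congr' ?_
  filter_upwards [eventually_unitInterval] with p hp
  have : (0 : ℝ) < p := by exact_mod_cast hp.1
  simp only [Function.comp]
  field_simp

lemma tendsto_secondMoment_mul : Tendsto
    (fun p : I => (p : ℝ) ^ 4 * (⨆ N, secondMomentY N p) / 4) (𝓝[>] 0) (𝓝 1) := by
  have hc : ContinuousAt (fun x : ℝ => x ^ 2 * (2 - x - x ^ 2) / 4 + 1 / (1 - x) ^ 4) 0 := by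
    fun_prop (disch := norm_num)
  have h : Tendsto (fun x : ℝ => x ^ 2 * (2 - x - x ^ 2) / 4 + 1 / (1 - x) ^ 4) (𝓝 0) (𝓝 1) := by
    simpa using hc.tendsto
  refine tendsto_of_tendsto_of_tendsto_of_le_of_le' tendsto_sq_mean_mul
    (h.comp tendsto_coe_unitInterval) ?_ ?_
  · filter_upwards [eventually_unitInterval] with p hp
    have hp0 : (0 : ℝ) < p := by exact_mod_cast hp.1
    gcongr
    refine le_of_tendsto_of_tendsto' ((tendsto_meanY hp.1 hp.2).pow 2)
      (tendsto_secondMomentY hp.1 hp.2) fun N => ?_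
    rw [meanY_eq, secondMomentY_eq]
    exact sq_bernoulliSum_le _ p.2.1 p.2.2 _
  · filter_upwards [eventually_unitInterval] with p hp
    have hp0 : (0 : ℝ) < p := by exact_mod_cast hp.1
    have hp1 : (p : ℝ) < 1 := by exact_mod_cast hp.2
    have hq : 0 < 1 - (p : ℝ) := sub_pos.2 hp1
    have hsup : ⨆ N, secondMomentY N p ≤ (2 / (p : ℝ) ^ 2 - 1 / (p : ℝ) - 1) +
        (2 / ((p : ℝ) ^ 2 * (1 - (p : ℝ)) ^ 2)) ^ 2 :=
      ciSup_le fun N => (secondMomentY_eq N p).trans_le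
        (bernoulliSum_missingCount_sq_le_limit hp0 hp1 N)
    calc (p : ℝ) ^ 4 * (⨆ N, secondMomentY N p) / 4
        ≤ (p : ℝ) ^ 4 * ((2 / (p : ℝ) ^ 2 - 1 / (p : ℝ) - 1) +
          (2 / ((p : ℝ) ^ 2 * (1 - (p : ℝ)) ^ 2)) ^ 2) / 4 := by gcongr
      _ = _ := by
        simp only [Function.comp]
        field_simp
        ring

lemma tendsto_relative_variance : Tendsto
    (fun p : I => ((⨆ N, secondMomentY N p) - (2 / (p : ℝ) ^ 2 - 1 / (p : ℝ) - 1) ^ 2) /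
      (2 / (p : ℝ) ^ 2 - 1 / (p : ℝ) - 1) ^ 2) (𝓝[>] 0) (𝓝 0) := by
  have h := (tendsto_secondMoment_mul.div tendsto_sq_mean_mul one_ne_zero).sub_const 1
  rw [div_one, sub_self] at h
  refine h.congr' ?_
  filter_upwards [eventually_unitInterval] with p hp
  have hp0 : (0 : ℝ) < p := by exact_mod_cast hp.1
  have hμ := (two_div_sq_sub_pos hp0 (by exact_mod_cast hp.2)).ne'
  simp only [Pi.div_apply]
  generalize 2 / (p : ℝ) ^ 2 - 1 / (p : ℝ) - 1 = μ at hμ ⊢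
  field_simp

theorem mainTheorem8 :
    ∃ EY EY2 : I → ℝ,
      -- `EY p` and `EY2 p` are the limits of `E[Y]` and `E[Y ^ 2]` as `N → ∞`
      (∀ p : I, 0 < p → p < 1 →
        Tendsto (fun N : ℕ => meanY N p) atTop (𝓝 (EY p)) ∧
        Tendsto (fun N : ℕ => secondMomentY N p) atTop (𝓝 (EY2 p)) ∧
        0 < EY p ∧
        EY p = 2 / (p : ℝ) ^ 2 - 1 / (p : ℝ) - 1) ∧
      Tendsto (fun p : I => (EY2 p - EY p ^ 2) / EY p ^ 2) (𝓝[>] 0) (𝓝 0) ∧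
      Tendsto (fun p : I => (p : ℝ) ^ 4 * EY2 p / 4 - 1) (𝓝[>] 0) (𝓝 0) ∧
      -- for small `p` and, depending on `p`, large `N`, the variable `Y / E[Y]` is close to `1`
      (∀ ε : ℝ, 0 < ε → ∀ η : ℝ, 0 < η →
        ∀ᶠ p : I in 𝓝[>] 0, ∀ᶠ N : ℕ in atTop,
          (randomSubset N p).real
            {A : Set ℕ | ε ≤ |(leftMissing N A : ℝ) / meanY N p - 1|} ≤ η) := by
  refine ⟨fun p => 2 / (p : ℝ) ^ 2 - 1 / (p : ℝ) - 1, fun p => ⨆ N, secondMomentY N p,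
    fun p h0 h1 => ⟨tendsto_meanY h0 h1, tendsto_secondMomentY h0 h1,
      two_div_sq_sub_pos (by exact_mod_cast h0) (by exact_mod_cast h1), rfl⟩,
    tendsto_relative_variance, ?_, fun ε hε η hη => ?_⟩
  · simpa using tendsto_secondMoment_mul.sub_const 1
  · filter_upwards [eventually_unitInterval, tendsto_relative_variance.eventually
      (gt_mem_nhds (show 0 < η * ε ^ 2 by positivity))] with p hp hvar
    have hμ := two_div_sq_sub_pos (p := (p : ℝ)) (by exact_mod_cast hp.1) (by exact_mod_cast hp.2)
    have hmean := tendsto_meanY hp.1 hp.2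
    have hlim := ((tendsto_secondMomentY hp.1 hp.2).sub (hmean.pow 2)).div (hmean.pow 2)
      (pow_ne_zero 2 hμ.ne')
    filter_upwards [hlim.eventually (gt_mem_nhds hvar), hmean.eventually (lt_mem_nhds hμ)]
      with N hN hpos
    classical
    rw [randomSubset_real_eq]
    simp only [Set.mem_ofPred_eq, leftMissing_coe]
    simp only [Pi.div_apply, secondMomentY_eq] at hN
    rw [meanY_eq] at hN hpos ⊢
    refine le_trans ?_ ((div_le_iff₀ (by positivity)).2 hN.le)
    convert bernoulliSum_deviation_le _ p.2.1 p.2.2 _ hpos.ne' hε
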